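/- Let $\kappa$ be an uncountable regular cardinal. A topological space is called $\kappa$-Lindelöf if each of its open covers has a subcover of cardinality $<\kappa$; the Lindelöf number of a topological space is the least infinite cardinal $\mu$ such that each open cover has a subcover of cardinality $\le\mu$. For a set $S$ let $$\Sigma_\kappa(S)=\{x\in[0,1]^S : |\{s\in S: x(s)\neq 0\}|<\kappa\}$$ with the topology inherited from the product $[0,1]^S$. A compact space $K$ is called $\kappa$-Corson if it is homeomorphic to a subspace of $\Sigma_\kappa(S)$ for some set $S$. A Boolean algebra $B$ is called $\kappa$-Corson if there is a set $G\subseteq B$ generating $B$ such that $|G\cap p|<\kappa$ for every ultrafilter $p$ of $B$. The pointwise topology $\tau_p$ on a Boolean algebra $B$ is the one with the subbase consisting of the sets $\{a\in B: a\in q\}$ and $\{a\in B: a\notin q\}$, where $q$ runs over all ultrafilters of $B$. (1) If $K$ is a $\kappa$-Corson compact space, then the space $C(K)$ of all continuous functions $K\to\mathbb R$, endowed with the topology of pointwise convergence, is $\kappa$-Lindelöf. (2) If $B$ is a $\kappa$-Corson Boolean algebra, then $(B,\tau_p)$ is $\kappa$-Lindelöf. In particular, if $\kappa=\lambda^+$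 for a cardinal $\lambda$, then the Lindelöf number of $(B,\tau_p)$ does not exceed $\lambda$. -/

import Mathlib

universe u

open Cardinal Topology

/-- A topology `t` on `X` is `κ`-Lindelöf if every open cover has a subcover of
cardinality `< κ`. -/
def IsKappaLindelof {X : Type u} (κ : Cardinal.{u}) (t : TopologicalSpace X) : Prop :=
  ∀ 𝒰 : Set (Set X), (∀ U ∈ 𝒰, IsOpen[t] U) → ⋃₀ 𝒰 = Set.univ →
    ∃ 𝒱 : Set (Set X), 𝒱 ⊆ 𝒰 ∧ ⋃₀ 𝒱 = Set.univ ∧ #𝒱 < κ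

/-- The Lindelöf number: the least infinite cardinal `μ` such that every open cover has a
subcover of cardinality `≤ μ`. -/
noncomputable def lindelofNumber {X : Type u} (t : TopologicalSpace X) : Cardinal.{u} :=
  sInf {μ : Cardinal.{u} | ℵ₀ ≤ μ ∧
    ∀ 𝒰 : Set (Set X), (∀ U ∈ 𝒰, IsOpen[t] U) → ⋃₀ 𝒰 = Set.univ →
      ∃ 𝒱 : Set (Set X), 𝒱 ⊆ 𝒰 ∧ ⋃₀ 𝒱 = Set.univ ∧ #𝒱 ≤ μ}

/-- `Σ_κ(S)`: the points of the cube `[0,1]^S` whose support has cardinality `< κ`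
(with the subspace topology of the product topology). -/
def sigmaProduct (κ : Cardinal.{u}) (S : Type u) : Set (S → unitInterval) :=
  {x | #{s : S | x s ≠ 0} < κ}

/-- A compact space is `κ`-Corson if it embeds topologically in `Σ_κ(S)` for some set `S`. -/
def IsKappaCorsonSpace (κ : Cardinal.{u}) (K : Type u) [TopologicalSpace K] : Prop :=
  CompactSpace K ∧ ∃ (S : Type u) (f : K → sigmaProduct κ S), Topology.IsEmbedding f

/-- The topology of pointwise convergence on `C(K)`. -/
abbrev pointwiseTopology (K : Type u) [TopologicalSpace K] : TopologicalSpace C(K, ℝ) :=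
  TopologicalSpace.induced (fun f : C(K, ℝ) => (f : K → ℝ)) Pi.topologicalSpace

/-- The ultrafilters of a Boolean algebra: the proper filters that contain each element or its
complement. -/
def BoolUlt (B : Type u) [BooleanAlgebra B] : Type u :=
  {p : Order.PFilter B // ⊥ ∉ p ∧ ∀ a : B, a ∈ p ∨ aᶜ ∈ p}

/-- A Boolean algebra is `κ`-Corson if it has a generating set that meets every ultrafilter in
fewer than `κ` elements. -/
def IsKappaCorsonAlgebra (κ : Cardinal.{u}) (B : Type u) [BooleanAlgebra B] : Prop :=
  ∃ G : Set B, BooleanSubalgebra.closure G = ⊤ ∧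
    ∀ p : BoolUlt B, #{a : B | a ∈ G ∧ a ∈ p.1} < κ

/-- The pointwise topology on a Boolean algebra: the topology with subbase the sets
`{a | a ∈ q}` and `{a | a ∉ q}` for ultrafilters `q`. -/
abbrev algebraPointwiseTopology (B : Type u) [BooleanAlgebra B] : TopologicalSpace B :=
  TopologicalSpace.generateFrom
    {V : Set B | ∃ q : BoolUlt B, V = {a | a ∈ q.1} ∨ V = {a | a ∉ q.1}}

/-! ### Cardinal bounds and closing off -/

section CardinalArithmetic

/-! Both parts follow from `isKappaLindelof_continuousMap`, a closing-off argument. Using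
`exists_closed_of_finitary`, choose a set `T` of fewer than `κ` coordinates such that every
satisfiable finite pattern of conditions on coordinates in `T` has a witnessing sequence of points
supported in `T`. Truncating a point of `K` to `T` gives a limit of witnesses, so by compactness
truncation is a continuous map `r : K → K`. Given `f`, some member of the cover contains `f ∘ r`,
because of its values at finitely many points `x n`. A witness close to the points `r (x n)` then
gives a member of the cover containing `f` itself, and there are fewer than `κ` patterns over `T`.

For algebras, Stone duality identifies `B` with the continuous maps from its Stone space to `Bool`;
a generating set `G` embeds that space in a power of `Bool`, with supports `G ∩ p`. -/

theorem mk_prod_mem_lt {κ : Cardinal.{u}} (hκ : ℵ₀ < κ) (A : Type) [Countable A] {B : Type u}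
    {s : Set B} (hs : #s < κ) : #{p : A × B | p.2 ∈ s} < κ := by
  have hinj : Function.Injective
      (fun p : {p : A × B | p.2 ∈ s} => ((p.1.1, ⟨p.1.2, p.2⟩) : A × s)) := by
    rintro ⟨⟨a, b⟩, h⟩ ⟨⟨a', b'⟩, h'⟩ heq
    simpa using heq
  refine (Cardinal.mk_le_of_injective hinj).trans_lt ?_
  rw [Cardinal.mk_prod]
  refine Cardinal.mul_lt_of_lt hκ.le (lt_of_le_of_lt ?_ hκ) (by simpa using hs)
  simp

theorem mk_finset_subset_lt {κ : Cardinal.{u}} (hκ : ℵ₀ < κ) {α : Type u} {s : Set α}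
    (hs : #s < κ) : #{c : Finset α | (c : Set α) ⊆ s} < κ := by
  classical
  have hle : #{c : Finset α | (c : Set α) ⊆ s} ≤ #(Finset s) := by
    refine Cardinal.mk_le_of_injective (f := fun c => c.1.subtype (· ∈ s)) ?_
    rintro ⟨c, hc⟩ ⟨d, hd⟩ h
    ext x
    have hx := fun hxs : x ∈ s => Finset.ext_iff.mp h ⟨x, hxs⟩
    simp only [Finset.mem_subtype] at hx
    exact ⟨fun h' => (hx (hc h')).1 h', fun h' => (hx (hd h')).2 h'⟩
  refine hle.trans_lt ?_
  cases finite_or_infinite s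
  · exact (Cardinal.lt_aleph0_of_finite _).trans hκ
  · rwa [Cardinal.mk_finset_of_infinite]

theorem mk_iUnion_nat_lt {κ : Cardinal.{u}} (hκ : ℵ₀ < κ) (hreg : κ.IsRegular) {α : Type u}
    {t : ℕ → Set α} (ht : ∀ n, #(t n) < κ) : #(⋃ n, t n) < κ := by
  have h : #(⋃ n : ULift.{u} ℕ, t n.down) < κ :=
    (Cardinal.card_iUnion_lt_iff_forall_of_isRegular hreg (by simpa using hκ)).2 fun n => ht n.down
  rwa [show ⋃ n : ULift.{u} ℕ, t n.down = ⋃ n, t n from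
    Equiv.ulift.surjective.iUnion_comp t] at h

/-- Closing off under finitary operations, each application of which adds fewer than `κ`
elements. -/
theorem exists_closed_of_finitary {κ : Cardinal.{u}} (hκ : ℵ₀ < κ) (hreg : κ.IsRegular)
    {S Q : Type u} (σ : Q → Finset S) (hσ : ∀ T : Set S, #T < κ → #{q | (σ q : Set S) ⊆ T} < κ)
    (φ : Q → Set S) (hφ : ∀ q, #(φ q) < κ) :
    ∃ T : Set S, #T < κ ∧ ∀ q, (σ q : Set S) ⊆ T → φ q ⊆ T := by
  let step : Set S → Set S := fun T => T ∪ ⋃ q ∈ {q | (σ q : Set S) ⊆ T}, φ q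
  let t : ℕ → Set S := fun n => step^[n] ∅
  have ht_succ (n) : t (n + 1) = step (t n) := Function.iterate_succ_apply' step n ∅
  have ht_card (n) : #(t n) < κ := by
    induction n with
    | zero => simpa [t] using hreg.pos
    | succ n ih =>
      rw [ht_succ]
      exact (Cardinal.mk_union_le _ _).trans_lt (Cardinal.add_lt_of_lt hκ.le ih
        ((Cardinal.card_biUnion_lt_iff_forall_of_isRegular hreg (hσ _ ih)).2 fun q _ => hφ q))
  have hmono : Monotone t := monotone_nat_of_le_succ fun n => by
    rw [ht_succ]; exact Set.subset_union_left
  refine ⟨⋃ n, t n, mk_iUnion_nat_lt hκ hreg ht_card, fun q hq => ?_⟩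
  -- Since `σ q` is finite, it already lies in one stage, so `ω` stages suffice.
  obtain ⟨n, hn⟩ :=
    (hmono.directed_le).exists_mem_subset_of_finset_subset_biUnion hq
  refine Set.Subset.trans ?_ (Set.subset_iUnion t (n + 1))
  rw [ht_succ]
  exact (Set.subset_biUnion_of_mem (u := φ) (show q ∈ {q | (σ q : Set S) ⊆ t n} from hn)).trans
    Set.subset_union_right

end CardinalArithmetic

/-! ### Continuous functions on a compact space with small supports -/

section FunctionSpace

open TopologicalSpace

/-- Basic neighbourhoods in a power of a second countable space. -/
theorem exists_finset_countableBasis {S Z : Type*} [TopologicalSpace Z] [SecondCountableTopology Z]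
    {O : Set (S → Z)} (hO : IsOpen O) {z : S → Z} (hz : z ∈ O) :
    ∃ c : Finset (S × countableBasis Z), (∀ p ∈ c, z p.1 ∈ p.2.1) ∧
      ∀ y : S → Z, (∀ p ∈ c, y p.1 ∈ p.2.1) → y ∈ O := by
  classical
  obtain ⟨_, ⟨V, F, hV, rfl⟩, hzV, hVO⟩ :=
    (isTopologicalBasis_pi fun _ : S => isBasis_countableBasis Z).exists_subset_of_mem_open hz hO
  refine ⟨F.attach.image fun s => (s.1, ⟨V s.1, hV s.1 s.2⟩), ?_, fun y hy => hVO ?_⟩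
  · simp only [Finset.mem_image, Finset.mem_attach, true_and, forall_exists_index]
    rintro _ s rfl
    exact hzV s.1 s.2
  · intro s hs
    exact hy (s, ⟨V s, hV s hs⟩) (Finset.mem_image.2 ⟨⟨s, hs⟩, Finset.mem_attach _ _, rfl⟩)

/-- Basic neighbourhoods for the topology of pointwise convergence, given by a sequence of points
and finitely many conditions taken from a countable set. -/
theorem exists_seq_finset_countableBasis {K Y : Type*} [Nonempty K] [TopologicalSpace Y]
    [SecondCountableTopology Y] {O : Set (K → Y)} (hO : IsOpen O) {f : K → Y} (hf : f ∈ O) :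
    ∃ (x : ℕ → K) (V : Finset (ℕ × countableBasis Y)), (∀ p ∈ V, f (x p.1) ∈ p.2.1) ∧
      ∀ g : K → Y, (∀ p ∈ V, g (x p.1) ∈ p.2.1) → g ∈ O := by
  classical
  obtain ⟨c, hfc, hcO⟩ := exists_finset_countableBasis hO hf
  obtain ⟨x₀⟩ := ‹Nonempty K›
  obtain ⟨x, hx⟩ := ((c.image Prod.fst).countable_toSet.insert x₀).exists_eq_range
    (Set.insert_nonempty _ _)
  have hmem : ∀ p ∈ c, ∃ n, x n = p.1 := fun p hp => by
    rw [← Set.mem_range, ← hx]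
    exact Or.inr (Finset.mem_coe.2 (Finset.mem_image_of_mem _ hp))
  choose! n hn using hmem
  refine ⟨x, c.image fun p => (n p, p.2), ?_, fun g hg => hcO g fun p hp => ?_⟩
  · simp only [Finset.mem_image, forall_exists_index, and_imp]
    rintro _ p hp rfl
    simpa only [hn p hp] using hfc p hp
  · simpa only [hn p hp] using hg _ (Finset.mem_image_of_mem _ hp)

/-- If a compact space embeds in a power of a second countable Hausdorff space in such a way that
all supports (with respect to a base point `o`) have cardinality `< κ`, then its continuous
functions into a second countable space form a `κ`-Lindelöf space in the topology of pointwise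
convergence. -/
theorem isKappaLindelof_continuousMap {κ : Cardinal.{u}} (hκ : ℵ₀ < κ) (hreg : κ.IsRegular)
    {K S : Type u} {Y Z : Type} [TopologicalSpace K] [CompactSpace K]
    [TopologicalSpace Z] [SecondCountableTopology Z] [T2Space Z]
    [TopologicalSpace Y] [SecondCountableTopology Y]
    (o : Z) {e : K → S → Z} (he : IsEmbedding e) (hsupp : ∀ x, #{s | e x s ≠ o} < κ) :
    IsKappaLindelof κ (TopologicalSpace.induced (fun f : C(K, Y) => (f : K → Y))
      Pi.topologicalSpace) := by
  classical
  intro 𝒰 h𝒰 hcov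
  have hcov' (f : C(K, Y)) : ∃ U ∈ 𝒰, f ∈ U := by
    rw [← Set.mem_sUnion, hcov]; trivial
  rcases isEmpty_or_nonempty K with hK | hK
  · obtain ⟨U, hU, hfU⟩ := hcov' ⟨isEmptyElim, continuous_of_const fun x => isEmptyElim x⟩
    refine ⟨{U}, by simpa using hU, ?_, ?_⟩
    · rw [Set.sUnion_singleton, Set.eq_univ_iff_forall]
      intro g
      convert hfU
    · simpa using Cardinal.one_lt_aleph0.trans hκ
  -- `some V` asks that the neighbourhood coded by `V` at the sequence fit inside one member of the
  -- cover; `none` asks nothing and serves only to build `r`.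
  let R : Option (Finset (ℕ × countableBasis Y)) → Set (ℕ → K) := fun j =>
    j.elim Set.univ fun V =>
      {x | ∃ U ∈ 𝒰, ∀ f : C(K, Y), (∀ p ∈ V, f (x p.1) ∈ p.2.1) → f ∈ U}
  let Q := Option (Finset (ℕ × countableBasis Y)) × Finset ((ℕ × countableBasis Z) × S)
  let good : Q → (ℕ → K) → Prop := fun q x =>
    x ∈ R q.1 ∧ ∀ p ∈ q.2, e (x p.1.1) p.2 ∈ p.1.2.1
  have hw : ∀ q : Q, ∃ w : ℕ → K, (∃ x, good q x) → good q w := fun q => by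
    by_cases h : ∃ x, good q x
    · exact ⟨h.choose, fun _ => h.choose_spec⟩
    · exact ⟨fun _ => hK.some, fun h' => (h h').elim⟩
  choose w hw using hw
  let σ : Q → Finset S := fun q => q.2.image Prod.snd
  have hσ (T : Set S) (hT : #T < κ) : #{q | (σ q : Set S) ⊆ T} < κ := by
    have h := mk_prod_mem_lt hκ (Option (Finset (ℕ × countableBasis Y)))
      (mk_finset_subset_lt hκ (mk_prod_mem_lt hκ (ℕ × countableBasis Z) hT))
    refine (Cardinal.mk_le_mk_of_subset ?_).trans_lt h
    intro q hq p hp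
    exact hq (Finset.mem_coe.2 (Finset.mem_image_of_mem _ hp))
  obtain ⟨T, hT, hclosed⟩ := exists_closed_of_finitary hκ hreg σ hσ
    (fun q => ⋃ n, {s | e (w q n) s ≠ o})
    (fun q => mk_iUnion_nat_lt hκ hreg fun n => hsupp _)
  have hzero {q : Q} (hq : (σ q : Set S) ⊆ T) (n : ℕ) {s : S} (hs : s ∉ T) : e (w q n) s = o := by
    by_contra h
    exact hs (hclosed q hq (Set.mem_iUnion.2 ⟨n, h⟩))
  -- conditions on a sequence of points with coordinates outside `T` equal to `o` are met by some
  -- `w q` as soon as those of them that concern `T` can be met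
  have key (j) (x : ℕ → K) (hx : x ∈ R j) (c : Finset ((ℕ × countableBasis Z) × S))
      (hc : ∀ p ∈ c, (if p.2 ∈ T then e (x p.1.1) p.2 else o) ∈ p.1.2.1) :
      ∃ q : Q, q.1 = j ∧ (σ q : Set S) ⊆ T ∧ w q ∈ R j ∧
        ∀ p ∈ c, e (w q p.1.1) p.2 ∈ p.1.2.1 := by
    let q : Q := (j, c.filter (·.2 ∈ T))
    have hq : (σ q : Set S) ⊆ T := by
      intro s hs
      obtain ⟨p, hp, rfl⟩ := Finset.mem_image.1 (Finset.mem_coe.1 hs)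
      exact (Finset.mem_filter.1 hp).2
    have hgood : good q (w q) := hw q ⟨x, hx, fun p hp => by
      obtain ⟨hp, hpT⟩ := Finset.mem_filter.1 hp
      simpa only [if_pos hpT] using hc p hp⟩
    refine ⟨q, rfl, hq, hgood.1, fun p hp => ?_⟩
    by_cases hpT : p.2 ∈ T
    · exact hgood.2 p (Finset.mem_filter.2 ⟨hp, hpT⟩)
    · rw [hzero hq _ hpT]
      simpa only [if_neg hpT] using hc p hp
  have hclosedRange : IsClosed (Set.range e) := (isCompact_range he.continuous).isClosed
  have hretr (x : K) : ∃ y, e y = fun s => if s ∈ T then e x s else o := by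
    rw [← Set.mem_range, ← hclosedRange.closure_eq, mem_closure_iff]
    intro O hO hxO
    obtain ⟨c, hc, hcO⟩ := exists_finset_countableBasis hO hxO
    -- Only one point is to be approximated, so a constant sequence is used and index `0` is read
    -- off.
    obtain ⟨q, -, -, -, hq⟩ := key none (fun _ => x) trivial
      (c.image fun p => ((0, p.2), p.1)) (by
        simp only [Finset.mem_image, forall_exists_index, and_imp]
        rintro _ p hp rfl
        exact hc p hp)
    exact ⟨e (w q 0), hcO _ fun p hp => hq _ (Finset.mem_image_of_mem _ hp), Set.mem_range_self _⟩
  choose r hr using hretr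
  have hrcont : Continuous r := by
    rw [he.continuous_iff, continuous_pi_iff]
    intro s
    simp only [Function.comp_def, hr]
    split_ifs
    · exact (continuous_apply s).comp he.continuous
    · exact continuous_const
  have hU : ∀ q : Q, ∃ U, ∀ V, q.1 = some V → w q ∈ R (some V) →
      U ∈ 𝒰 ∧ ∀ f : C(K, Y), (∀ p ∈ V, f (w q p.1) ∈ p.2.1) → f ∈ U := by
    intro q
    by_cases h : ∃ V, q.1 = some V ∧ w q ∈ R (some V)
    · obtain ⟨V, hV, U, hU⟩ := h
      refine ⟨U, fun V' hV' _ => ?_⟩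
      cases hV.symm.trans hV'
      exact hU
    · exact ⟨∅, fun V hV hR => (h ⟨V, hV, hR⟩).elim⟩
  choose U hU using hU
  -- Intersecting with `𝒰` discards values of `U` at patterns where nothing is guaranteed.
  refine ⟨U '' {q | (σ q : Set S) ⊆ T} ∩ 𝒰, Set.inter_subset_right, ?_,
    ((Cardinal.mk_le_mk_of_subset Set.inter_subset_left).trans Cardinal.mk_image_le).trans_lt
      (hσ T hT)⟩
  rw [Set.eq_univ_iff_forall]
  intro f
  -- The cover is applied to `f ∘ r` because only the truncated points `r (x n)` can be approximated
  -- by witnesses supported in `T`.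
  obtain ⟨U₀, hU₀, hfU₀⟩ := hcov' (f.comp ⟨r, hrcont⟩)
  obtain ⟨O, hO, rfl⟩ := isOpen_induced_iff.1 (h𝒰 U₀ hU₀)
  obtain ⟨x, V, hfV, hVO⟩ := exists_seq_finset_countableBasis hO hfU₀
  have hnhds : ∀ p ∈ V, ∃ c : Finset (S × countableBasis Z),
      (∀ d ∈ c, e (r (x p.1)) d.1 ∈ d.2.1) ∧
      ∀ y, (∀ d ∈ c, e y d.1 ∈ d.2.1) → f y ∈ p.2.1 := fun p hp => by
    obtain ⟨N, hN, hNf⟩ := he.isOpen_iff.1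
      ((isOpen_of_mem_countableBasis p.2.2).preimage f.continuous)
    have hmem : e (r (x p.1)) ∈ N := by
      rw [← Set.mem_preimage, hNf]
      exact hfV p hp
    obtain ⟨c, hc, hcN⟩ := exists_finset_countableBasis hN hmem
    refine ⟨c, hc, fun y hy => ?_⟩
    have := hcN _ hy
    rwa [← Set.mem_preimage, hNf] at this
  choose! c hc hcf using hnhds
  obtain ⟨q, hqV, hq, hwR, hwc⟩ := key (some V) x ⟨_, hU₀, fun g hg => hVO g hg⟩
    (V.biUnion fun p => (c p).image fun d => ((p.1, d.2), d.1)) (by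
      simp only [Finset.mem_biUnion, Finset.mem_image, forall_exists_index, and_imp]
      rintro _ p hp d hd rfl
      simpa only [hr] using hc p hp d hd)
  obtain ⟨hU𝒰, hUf⟩ := hU q V hqV hwR
  refine ⟨U q, ⟨⟨q, hq, rfl⟩, hU𝒰⟩, hUf f fun p hp => hcf p hp _ fun d hd => ?_⟩
  exact hwc ((p.1, d.2), d.1)
    (Finset.mem_biUnion.2 ⟨p, hp, Finset.mem_image_of_mem (fun d => ((p.1, d.2), d.1)) hd⟩)

end FunctionSpace

/-! ### Stone duality and Corson algebras -/

section StoneSpace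

variable {B : Type u} [BooleanAlgebra B]

namespace BoolUlt

theorem compl_mem_iff (q : BoolUlt B) {a : B} : aᶜ ∈ q.1 ↔ a ∉ q.1 := by
  refine ⟨fun h h' => q.2.1 ?_, fun h => (q.2.2 a).resolve_left h⟩
  simpa using Order.PFilter.inf_mem h' h

theorem sup_mem_iff (q : BoolUlt B) {a b : B} : a ⊔ b ∈ q.1 ↔ a ∈ q.1 ∨ b ∈ q.1 := by
  rw [← not_iff_not, ← compl_mem_iff, compl_sup, Order.PFilter.inf_mem_iff, compl_mem_iff,
    compl_mem_iff, not_or]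

/-- The Stone topology on the set of ultrafilters. -/
instance instTopologicalSpace : TopologicalSpace (BoolUlt B) :=
  TopologicalSpace.generateFrom (Set.range fun a : B => {q : BoolUlt B | a ∈ q.1})

theorem isOpen_setOf_mem (a : B) : IsOpen {q : BoolUlt B | a ∈ q.1} :=
  TopologicalSpace.isOpen_generateFrom_of_mem ⟨a, rfl⟩

theorem isClopen_setOf_mem (a : B) : IsClopen {q : BoolUlt B | a ∈ q.1} := by
  refine ⟨⟨?_⟩, isOpen_setOf_mem a⟩
  convert isOpen_setOf_mem aᶜ using 1
  ext q
  exact q.compl_mem_iff.symm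

theorem isTopologicalBasis :
    TopologicalSpace.IsTopologicalBasis
      (Set.range fun a : B => {q : BoolUlt B | a ∈ q.1}) where
  exists_subset_inter := by
    rintro _ ⟨a, rfl⟩ _ ⟨b, rfl⟩ q hq
    refine ⟨_, ⟨a ⊓ b, rfl⟩, Order.PFilter.inf_mem hq.1 hq.2, fun p hp => ?_⟩
    exact Order.PFilter.inf_mem_iff.1 hp
  sUnion_eq := Set.eq_univ_of_forall fun q => ⟨_, ⟨⊤, rfl⟩, Order.PFilter.top_mem⟩
  eq_generateFrom := rfl

/-- An ultrafilter `𝓕` on the Stone space converges to the point consisting of those `a` whose basic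
clopen set belongs to `𝓕`. -/
instance instCompactSpace : CompactSpace (BoolUlt B) := by
  refine ⟨isCompact_iff_ultrafilter_le_nhds.2 fun 𝓕 _ => ?_⟩
  have hF : Order.IsPFilter {a : B | {q : BoolUlt B | a ∈ q.1} ∈ 𝓕} := by
    refine Order.IsPFilter.of_def ⟨⊤, ?_⟩ ?_ ?_
    · exact Filter.mem_of_superset Filter.univ_mem fun q _ => Order.PFilter.top_mem
    · intro a ha b hb
      refine ⟨a ⊓ b, ?_, inf_le_left, inf_le_right⟩
      exact Filter.mem_of_superset (Filter.inter_mem ha hb) fun q hq =>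
        Order.PFilter.inf_mem hq.1 hq.2
    · intro a b hab ha
      exact Filter.mem_of_superset ha fun q hq => Order.PFilter.mem_of_le hab hq
  let p : BoolUlt B := ⟨hF.toPFilter, by
    change {q : BoolUlt B | ⊥ ∈ q.1} ∉ 𝓕
    have : {q : BoolUlt B | ⊥ ∈ q.1} = ∅ := Set.eq_empty_of_forall_notMem fun q => q.2.1
    rw [this]
    exact 𝓕.empty_notMem, fun a => by
    change {q : BoolUlt B | a ∈ q.1} ∈ 𝓕 ∨ {q : BoolUlt B | aᶜ ∈ q.1} ∈ 𝓕
    rw [← Ultrafilter.union_mem_iff]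
    exact Filter.mem_of_superset Filter.univ_mem fun q _ => q.2.2 a⟩
  refine ⟨p, trivial, ?_⟩
  rw [TopologicalSpace.nhds_generateFrom]
  refine le_iInf₂ fun s hs => ?_
  obtain ⟨hps, a, rfl⟩ := hs
  exact Filter.le_principal_iff.2 hps

/-- Every clopen set of ultrafilters is the set of ultrafilters containing some element. -/
theorem exists_eq_setOf_mem {C : Set (BoolUlt B)} (hC : IsClopen C) :
    ∃ a : B, C = {q | a ∈ q.1} := by
  obtain ⟨F, hF, rfl⟩ := eq_finite_iUnion_of_isTopologicalBasis_of_isCompact_open _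
    isTopologicalBasis C hC.isClosed.isCompact hC.isOpen
  clear hC
  induction F, hF using Set.Finite.induction_on with
  | empty => exact ⟨⊥, by ext q; simpa using q.2.1⟩
  | @insert a F _ _ ih =>
    obtain ⟨b, hb⟩ := ih
    refine ⟨a ⊔ b, ?_⟩
    rw [Set.biUnion_insert, hb]
    ext q
    exact q.sup_mem_iff.symm

/-- Ultrafilters that agree on a generating set are equal. -/
theorem eq_of_closure_eq_top {G : Set B} (hG : BooleanSubalgebra.closure G = ⊤)
    {p q : BoolUlt B} (h : ∀ a ∈ G, a ∈ p.1 ↔ a ∈ q.1) : p = q := by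
  suffices ∀ a, a ∈ p.1 ↔ a ∈ q.1 from Subtype.ext (SetLike.ext this)
  intro a
  have ha : a ∈ BooleanSubalgebra.closure G := by rw [hG]; trivial
  induction ha using BooleanSubalgebra.closure_bot_sup_induction with
  | mem a ha => exact h a ha
  | bot => exact iff_of_false p.2.1 q.2.1
  | sup a _ b _ iha ihb => exact p.sup_mem_iff.trans ((or_congr iha ihb).trans q.sup_mem_iff.symm)
  | compl a _ iha => exact p.compl_mem_iff.trans ((not_congr iha).trans q.compl_mem_iff.symm)

open Classical in
/-- An element of a Boolean algebra as a two-valued continuous function on the Stone space. -/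
noncomputable def evalMap (a : B) : C(BoolUlt B, Bool) :=
  ⟨fun q => decide (a ∈ q.1), by
    rw [continuous_bool_rng true]
    simpa [Set.preimage] using isClopen_setOf_mem a⟩

@[simp]
theorem evalMap_apply_eq_true {a : B} {q : BoolUlt B} : evalMap a q = true ↔ a ∈ q.1 := by
  simp [evalMap]

theorem evalMap_surjective : Function.Surjective (evalMap (B := B)) := by
  intro f
  obtain ⟨a, ha⟩ := exists_eq_setOf_mem
    ((isClopen_discrete {true}).preimage f.continuous)
  refine ⟨a, ContinuousMap.ext fun q => Bool.eq_iff_iff.2 ?_⟩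
  rw [evalMap_apply_eq_true]
  exact (Set.ext_iff.1 ha q).symm

/-- One inequality is enough, since the `κ`-Lindelöf property passes to coarser topologies. -/
theorem induced_evalMap_le :
    TopologicalSpace.induced evalMap (TopologicalSpace.induced
      (fun f : C(BoolUlt B, Bool) => (f : BoolUlt B → Bool)) Pi.topologicalSpace) ≤
    algebraPointwiseTopology B := by
  refine le_generateFrom ?_
  have h (q : BoolUlt B) (s : Set Bool) : IsOpen ((fun f : BoolUlt B → Bool => f q) ⁻¹' s) :=
    (isOpen_discrete s).preimage (continuous_apply q)
  rintro _ ⟨q, rfl | rfl⟩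
  · exact ⟨_, ⟨_, h q {true}, rfl⟩, by ext a; simp⟩
  · exact ⟨_, ⟨_, h q {true}ᶜ, rfl⟩, by ext a; simp [← evalMap_apply_eq_true]⟩

/-- The Stone space of an algebra embeds in a power of the two-point space via any generating
set. -/
theorem isEmbedding_evalMap_of_closure_eq_top {G : Set B}
    (hG : BooleanSubalgebra.closure G = ⊤) :
    IsEmbedding fun (q : BoolUlt B) (a : G) => evalMap a.1 q := by
  -- A continuous injection of a compact space into a Hausdorff space is a closed embedding.
  refine (Continuous.isClosedEmbedding ?_ fun p q hpq => ?_).isEmbedding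
  · exact continuous_pi fun a => (evalMap a.1).continuous
  · refine eq_of_closure_eq_top hG fun a ha => ?_
    rw [← evalMap_apply_eq_true, ← evalMap_apply_eq_true]
    exact Bool.eq_iff_iff.1 (congrFun hpq ⟨a, ha⟩)

end BoolUlt

theorem IsKappaLindelof.of_induced_le {κ : Cardinal.{u}} {X Y : Type u} {tX : TopologicalSpace X}
    {tY : TopologicalSpace Y} (h : IsKappaLindelof κ tY) {f : X → Y}
    (hf : Function.Surjective f) (hle : tY.induced f ≤ tX) : IsKappaLindelof κ tX := by
  intro 𝒰 h𝒰 hcov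
  obtain ⟨𝒱, h𝒱, hcov𝒱, hcard⟩ := h {O | IsOpen[tY] O ∧ f ⁻¹' O ∈ 𝒰} (fun O hO => hO.1) (by
    refine Set.eq_univ_of_forall fun y => ?_
    obtain ⟨x, rfl⟩ := hf y
    obtain ⟨U, hU, hxU⟩ : x ∈ ⋃₀ 𝒰 := hcov ▸ Set.mem_univ x
    obtain ⟨O, hO, rfl⟩ := hle U (h𝒰 U hU)
    exact ⟨O, ⟨hO, hU⟩, hxU⟩)
  refine ⟨(f ⁻¹' ·) '' 𝒱, ?_, ?_, Cardinal.mk_image_le.trans_lt hcard⟩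
  · rintro _ ⟨O, hO, rfl⟩
    exact (h𝒱 hO).2
  · refine Set.eq_univ_of_forall fun x => ?_
    obtain ⟨O, hO, hxO⟩ : f x ∈ ⋃₀ 𝒱 := hcov𝒱 ▸ Set.mem_univ (f x)
    exact ⟨_, ⟨O, hO, rfl⟩, hxO⟩

theorem IsKappaCorsonAlgebra.isKappaLindelof {κ : Cardinal.{u}} (hκ : ℵ₀ < κ)
    (hreg : κ.IsRegular) (hB : IsKappaCorsonAlgebra κ B) :
    IsKappaLindelof κ (algebraPointwiseTopology B) := by
  obtain ⟨G, hG, hcard⟩ := hB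
  refine (isKappaLindelof_continuousMap hκ hreg false
    (BoolUlt.isEmbedding_evalMap_of_closure_eq_top hG) fun q => ?_).of_induced_le
    BoolUlt.evalMap_surjective BoolUlt.induced_evalMap_le
  refine lt_of_le_of_lt ?_ (hcard q)
  refine Cardinal.mk_le_of_injective
    (f := fun a => ⟨a.1.1, a.1.2, ?_⟩) fun a b hab => ?_
  · simpa using a.2
  · have hval : a.1.1 = b.1.1 := congrArg (fun c => c.1) hab
    exact Subtype.ext (Subtype.ext hval)

end StoneSpace

/-! ### Corson spaces, the Lindelöf number and the conclusion -/

theorem IsKappaCorsonSpace.isKappaLindelof {κ : Cardinal.{u}} (hκ : ℵ₀ < κ) (hreg : κ.IsRegular)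
    {K : Type u} [TopologicalSpace K] (hK : IsKappaCorsonSpace κ K) :
    IsKappaLindelof κ (pointwiseTopology K) := by
  obtain ⟨_, S, f, hf⟩ := hK
  exact isKappaLindelof_continuousMap hκ hreg 0 (IsEmbedding.subtypeVal.comp hf) fun x => (f x).2

theorem IsKappaLindelof.lindelofNumber_le {μ : Cardinal.{u}} (hμ : ℵ₀ ≤ μ) {X : Type u}
    {t : TopologicalSpace X} (h : IsKappaLindelof (Order.succ μ) t) : lindelofNumber t ≤ μ := by
  refine csInf_le' ⟨hμ, fun 𝒰 h𝒰 hcov => ?_⟩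
  obtain ⟨𝒱, h𝒱, hcov𝒱, hcard⟩ := h 𝒰 h𝒰 hcov
  exact ⟨𝒱, h𝒱, hcov𝒱, Order.lt_succ_iff.1 hcard⟩

theorem mainTheorem4 (κ : Cardinal.{u}) (hκ : ℵ₀ < κ) (hreg : κ.IsRegular) :
    (∀ (K : Type u) [TopologicalSpace K], IsKappaCorsonSpace κ K →
      IsKappaLindelof κ (pointwiseTopology K)) ∧
    (∀ (B : Type u) [BooleanAlgebra B], IsKappaCorsonAlgebra κ B →
      IsKappaLindelof κ (algebraPointwiseTopology B) ∧
      ∀ μ : Cardinal.{u}, κ = Order.succ μ →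
        lindelofNumber (algebraPointwiseTopology B) ≤ μ) := by
  refine ⟨fun K _ hK => hK.isKappaLindelof hκ hreg, fun B _ hB => ?_⟩
  have h := hB.isKappaLindelof hκ hreg
  refine ⟨h, ?_⟩
  rintro μ rfl
  exact h.lindelofNumber_le (Order.lt_succ_iff.1 hκ)
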